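/- Let $N\ge 0$ and let $\mathbb{H}^N\cong\mathbb{C}^N\times\mathbb{C}^N\ni(z,w)$ be acted on by the torus $T^N=\{\zeta\in\mathbb{C}^N : |\zeta_i|=1\}$ via $(z,w)\zeta=(z\zeta,w\zeta^{-1})$. Let $K\subseteq T^N$ be a connected subtorus (a closed connected subgroup) with Lie algebra $\iota\colon k\hookrightarrow t^N=\mathbb{R}^N$, let $u_1,\dots,u_N$ be the coordinate functions on $t^N$, and let $k^*_{\mathbb{C}}=k^*\otimes\mathbb{C}$. Let $\mu=(\mu_1,\mu_{\mathbb{C}})\colon\mathbb{H}^N\to k^*\times k^*_{\mathbb{C}}$ be the hyperkähler moment map $$\mu_1(z,w)=\pi\sum_{i=1}^N(|z_i|^2-|w_i|^2)\,\iota^*u_i,\qquad \mu_{\mathbb{C}}(z,w)=-2\pi\sqrt{-1}\sum_{i=1}^N z_iw_i\,\iota^*u_i,$$ and let $(k^*\times k^*_{\mathbb{C}})_{reg}$ be its set of regular values. Put $X(\alpha,\beta)=\mu^{-1}(\alpha,\beta)/K$ and $L(\alpha)=\mu_1^{-1}(\alpha)/K$. Suppose $(\alpha,0)\in(k^*\times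 k^*_{\mathbb{C}})_{reg}$. Then $L(\alpha)$ is diffeomorphic to the product $X(\alpha,0)\times k^*_{\mathbb{C}}$. In particular, $X(\alpha,0)$ is homotopy equivalent to $L(\alpha)$. Here $L(\alpha)$ and $X(\alpha,0)\times k^*_{\mathbb{C}}=(\mu^{-1}(\alpha,0)\times k^*_{\mathbb{C}})/K$ are orbifolds, quotients of submanifolds by locally free $K$-actions, and a diffeomorphism is a homeomorphism of the quotients which, like its inverse, lifts near each point to a smooth map between those submanifolds. -/

import Mathlib

open scoped ContDiff Topology

namespace ToricHK

/-- The quaternionic vector space `ℍ^N`, identified with `ℂ^N × ℂ^N` by `ξ = z + w I₂`.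
Only its structure as a finite-dimensional real vector space matters for smoothness. -/
abbrev HN (N : ℕ) : Type := (Fin N → ℂ) × (Fin N → ℂ)

/-- The real torus `T^N`. -/
abbrev Torus (N : ℕ) : Type := Fin N → Circle

/-- The action `(z, w) ζ = (z ζ, w ζ⁻¹)` of `T^N` on `ℍ^N` (the torus is commutative, so left and
right actions are the same thing). -/
noncomputable def act {N : ℕ} (ζ : Torus N) (p : HN N) : HN N :=
  (fun i => (ζ i : ℂ) * p.1 i, fun i => ((ζ i)⁻¹ : Circle) * p.2 i)

theorem act_one {N : ℕ} (p : HN N) : act 1 p = p := by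
  ext i <;> simp [act]

theorem act_mul {N : ℕ} (ζ η : Torus N) (p : HN N) : act (ζ * η) p = act ζ (act η p) := by
  ext i <;> simp [act] <;> ring

/-- The exponential map `t^N → T^N`, normalised so that its kernel is the lattice `ℤ^N`. -/
noncomputable def torusExp {N : ℕ} (x : Fin N → ℝ) : Torus N :=
  fun i => Circle.exp (2 * Real.pi * x i)

theorem torusExp_zero {N : ℕ} : torusExp (0 : Fin N → ℝ) = 1 := by
  ext i; simp [torusExp]

theorem torusExp_add {N : ℕ} (x y : Fin N → ℝ) :
    torusExp (x + y) = torusExp x * torusExp y := by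
  funext i; simp [torusExp, mul_add, Circle.exp_add]

/-- The Lie algebra `k ⊆ t^N = ℝ^N` of a closed subgroup `K ⊆ T^N`: the generators of the
one-parameter subgroups that lie in `K`. -/
noncomputable def lieAlg {N : ℕ} (K : Subgroup (Torus N)) : Submodule ℝ (Fin N → ℝ) where
  carrier := {x | ∀ t : ℝ, torusExp (t • x) ∈ K}
  zero_mem' := by
    intro t
    rw [smul_zero, torusExp_zero]
    exact K.one_mem
  add_mem' := by
    intro x y hx hy t
    rw [smul_add, torusExp_add]
    exact K.mul_mem (hx t) (hy t)
  smul_mem' := by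
    intro c x hx t
    rw [smul_smul]
    exact hx (t * c)

/-- The Lie algebra `k` as a type, with the norm and vector space structure induced from `ℝ^N`. -/
def Lie {N : ℕ} (K : Subgroup (Torus N)) : Type := ↥(lieAlg K)

noncomputable instance {N : ℕ} (K : Subgroup (Torus N)) : NormedAddCommGroup (Lie K) :=
  inferInstanceAs (NormedAddCommGroup ↥(lieAlg K))

noncomputable instance {N : ℕ} (K : Subgroup (Torus N)) : NormedSpace ℝ (Lie K) :=
  inferInstanceAs (NormedSpace ℝ ↥(lieAlg K))

instance {N : ℕ} (K : Subgroup (Torus N)) : FiniteDimensional ℝ (Lie K) :=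
  inferInstanceAs (FiniteDimensional ℝ ↥(lieAlg K))

/-- The inclusion `ι : k → t^N = ℝ^N`. -/
noncomputable def iota {N : ℕ} (K : Subgroup (Torus N)) : Lie K →L[ℝ] (Fin N → ℝ) :=
  (lieAlg K).subtypeL

/-- The dual space `k^*`. -/
abbrev kDual {N : ℕ} (K : Subgroup (Torus N)) : Type := Lie K →L[ℝ] ℝ

/-- The complexified dual space `k_ℂ^* = k^* ⊗ ℂ`, as the space of real-linear maps `k → ℂ`. -/
abbrev kDualC {N : ℕ} (K : Subgroup (Torus N)) : Type := Lie K →L[ℝ] ℂ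

/-- `ι^* u_i ∈ k^*`, where `u_i` is the `i`-th coordinate on `t^N = ℝ^N`. -/
noncomputable def iotaU {N : ℕ} (K : Subgroup (Torus N)) (i : Fin N) : kDual K :=
  (ContinuousLinearMap.proj (R := ℝ) (φ := fun _ : Fin N => ℝ) i).comp (iota K)

/-- `μ₁(z, w) = π ∑ (|z_i|² - |w_i|²) ι^* u_i`. -/
noncomputable def mu1 {N : ℕ} (K : Subgroup (Torus N)) (p : HN N) : kDual K :=
  Real.pi • ∑ i, (‖p.1 i‖ ^ 2 - ‖p.2 i‖ ^ 2) • iotaU K i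

/-- `μ_ℂ(z, w) = -2 π √-1 ∑ z_i w_i ι^* u_i`. Here `u.smulRight c`, the map `x ↦ u(x) c`, is the
multiple `c u ∈ k_ℂ^*` of `u ∈ k^*` by the complex number `c`. -/
noncomputable def muC {N : ℕ} (K : Subgroup (Torus N)) (p : HN N) : kDualC K :=
  ∑ i, (iotaU K i).smulRight (-2 * (Real.pi : ℂ) * Complex.I * (p.1 i * p.2 i))

/-- The hyperkähler moment map `μ = (μ₁, μ_ℂ) : ℍ^N → k^* × k_ℂ^*`. -/
noncomputable def mu {N : ℕ} (K : Subgroup (Torus N)) (p : HN N) : kDual K × kDualC K :=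
  (mu1 K p, muC K p)

/-- `(k^* × k_ℂ^*)_reg`, the set of regular values of the (polynomial) map `μ`. -/
def regularValues {N : ℕ} (K : Subgroup (Torus N)) : Set (kDual K × kDualC K) :=
  {c | ∀ p : HN N, mu K p = c → Function.Surjective (fderiv ℝ (mu K) p)}

/-- The orbit equivalence relation of `K` on a subset of `ℍ^N`. -/
def orbitSetoid {N : ℕ} (K : Subgroup (Torus N)) (S : Set (HN N)) : Setoid S where
  r p q := ∃ ζ ∈ K, act ζ (p : HN N) = q
  iseqv :=
    { refl := fun p => ⟨1, K.one_mem, act_one _⟩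
      symm := by
        rintro p q ⟨ζ, hζ, h⟩
        refine ⟨ζ⁻¹, K.inv_mem hζ, ?_⟩
        rw [← h, ← act_mul, inv_mul_cancel, act_one]
      trans := by
        rintro p q r ⟨ζ, hζ, h⟩ ⟨η, hη, h'⟩
        refine ⟨η * ζ, K.mul_mem hη hζ, ?_⟩
        rw [act_mul, h, h'] }

/-- The level set `μ⁻¹(α, β) ⊆ ℍ^N`. -/
def hkLevel {N : ℕ} (K : Subgroup (Torus N)) (α : kDual K) (β : kDualC K) : Set (HN N) :=
  {p | mu K p = (α, β)}

/-- The level set `μ₁⁻¹(α) ⊆ ℍ^N`. -/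
def mu1Level {N : ℕ} (K : Subgroup (Torus N)) (α : kDual K) : Set (HN N) :=
  {p | mu1 K p = α}

/-- The toric hyperkähler variety `X(α, β) = μ⁻¹(α, β) / K`, with the quotient topology. -/
abbrev X {N : ℕ} (K : Subgroup (Torus N)) (α : kDual K) (β : kDualC K) : Type :=
  Quotient (orbitSetoid K (hkLevel K α β))

/-- The toric variety `L(α) = μ₁⁻¹(α) / K`, with the quotient topology. -/
abbrev L {N : ℕ} (K : Subgroup (Torus N)) (α : kDual K) : Type :=
  Quotient (orbitSetoid K (mu1Level K α))

/-- The projection `μ₁⁻¹(α) → L(α)`. -/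
def projL {N : ℕ} (K : Subgroup (Torus N)) (α : kDual K) : mu1Level K α → L K α :=
  Quotient.mk _

/-- The projection `μ⁻¹(α, β) × k_ℂ^* → X(α, β) × k_ℂ^*`, presenting the product of the orbifold
`X(α, β)` and the vector space `k_ℂ^*` as the quotient of `μ⁻¹(α, β) × k_ℂ^*` by `K`. -/
def projXV {N : ℕ} (K : Subgroup (Torus N)) (α : kDual K) (β : kDualC K) :
    (hkLevel K α β ×ˢ (Set.univ : Set (kDualC K)) : Set (HN N × kDualC K)) →
      X K α β × kDualC K :=
  fun x => (Quotient.mk _ ⟨x.1.1, x.2.1⟩, x.1.2)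

/-- Let `X` and `Y` be orbifolds presented as quotients `a : A → X`, `b : B → Y` of submanifolds
`A ⊆ E`, `B ⊆ F` by locally free actions of a torus. A map `f : X → Y` is smooth if around every
point it lifts to a smooth map `A → B`; smoothness on the submanifold `A` means having local
smooth extensions to open subsets of `E`. (Slices for the actions are orbifold charts, and local
lifts between neighbourhoods in `A` and `B` are the same as local lifts between slices.) -/
def OrbifoldSmooth {E F : Type*} [NormedAddCommGroup E] [NormedSpace ℝ E]
    [NormedAddCommGroup F] [NormedSpace ℝ F] {A : Set E} {B : Set F} {X Y : Type*}
    (a : A → X) (b : B → Y) (f : X → Y) : Prop :=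
  ∀ p : A, ∃ U : Set E, IsOpen U ∧ (p : E) ∈ U ∧ ∃ s : E → F, ContDiffOn ℝ ∞ s U ∧
    ∀ x : A, (x : E) ∈ U → ∃ h : s x ∈ B, b ⟨s x, h⟩ = f (a x)

/-- Orbifolds presented as quotients are diffeomorphic if there is a homeomorphism between them
that is smooth in both directions. -/
def OrbifoldDiffeomorphic {E F : Type*} [NormedAddCommGroup E] [NormedSpace ℝ E]
    [NormedAddCommGroup F] [NormedSpace ℝ F] {A : Set E} {B : Set F} {X Y : Type*}
    [TopologicalSpace X] [TopologicalSpace Y] (a : A → X) (b : B → Y) : Prop :=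
  ∃ Φ : X ≃ₜ Y, OrbifoldSmooth a b Φ ∧ OrbifoldSmooth b a Φ.symm

end ToricHK

/-! Split `k_ℂ^* = k^* ⊕ k^*` by the directions `e = 1` and `e = √-1` of `z_i w_i`. For each `e` the
imaginary part of the complexified torus, for the complex structure attached to `e`, acts by
hyperbolic rotations (`push`). These preserve every `|z_i|² - |w_i|²`, hence `μ₁`, and also the
component of `z_i w_i` orthogonal to `e`, while the `e`-component becomes `h cosh 2t + (r/2) sinh
2t` with `t = ℓ_i x`, `h = Re (ē z_i w_i)`, `r = |z_i|² + |w_i|²`.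

Along an orbit the `e`-component of the moment map is therefore the gradient in `x` of a convex
function. When the `ℓ_i` with `|z_i| ≠ |w_i|` span the dual, that function is strictly convex and
coercive, so each value in `k^*` is attained exactly once, and smoothly in the data
(`injective_reMoment_push`, `surjective_reMoment_push`, `contDiffAt_slideParam`). Regularity of `(α,
0)` gives this spanning condition on all of `μ₁⁻¹(α)` (`mu1Level_subset_spanningLocus`).

Sliding both components to zero while recording `μ_ℂ` gives a `K`-equivariant diffeomorphism
`μ₁⁻¹(α) ≅ μ⁻¹(α, 0) × k_ℂ^*`, which descends to the quotients. The factor `k_ℂ^*` is contractible.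
-/

namespace ToricHK

/-! ### Gradients of sums of convex functions of linear forms -/

section Monotone

variable {ι V : Type*} [Fintype ι] [NormedAddCommGroup V] [NormedSpace ℝ V]

theorem mul_sq_le_of_le_deriv {g g' : ℝ → ℝ} {κ : ℝ} (hg : ∀ t, HasDerivAt g (g' t) t)
    (hκ : ∀ t, κ ≤ g' t) (s t : ℝ) : κ * (s - t) ^ 2 ≤ (g s - g t) * (s - t) := by
  have hd : ∀ t, HasDerivAt (fun t => g t - κ * t) (g' t - κ) t := fun t => by
    simpa using (hg t).fun_sub ((hasDerivAt_id t).const_mul κ)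
  have hm : Monotone fun t => g t - κ * t :=
    monotone_of_deriv_nonneg (fun t => (hd t).differentiableAt) fun t => by
      rw [(hd t).deriv]; linarith [hκ t]
  rcases le_total s t with h | h
  · have := hm h
    nlinarith
  · have := hm h
    nlinarith

theorem eq_zero_of_sum_nonpos {ℓ : ι → V →L[ℝ] ℝ} {κ : ι → ℝ} (hκ0 : ∀ i, 0 ≤ κ i)
    (hsep : ∀ x, (∀ i, κ i * ℓ i x = 0) → x = 0) {v : V}
    (h : ∑ i, κ i * ℓ i v ^ 2 ≤ 0) : v = 0 := by
  refine hsep v fun i => ?_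
  have h0 : ∑ i, κ i * ℓ i v ^ 2 = 0 :=
    le_antisymm h (Finset.sum_nonneg fun i _ => mul_nonneg (hκ0 i) (sq_nonneg _))
  have := (Finset.sum_eq_zero_iff_of_nonneg
    fun i _ => mul_nonneg (hκ0 i) (sq_nonneg (ℓ i v))).1 h0 i (Finset.mem_univ i)
  rcases mul_eq_zero.1 this with h | h
  · simp [h]
  · simp [pow_eq_zero_iff two_ne_zero |>.1 h]

/-- Strong monotonicity: pairing the difference of two values with `x - x'` bounds `∑ κ_i ℓ_i(x -
x')²` from above by zero. -/
theorem injective_sum_smul {ℓ : ι → V →L[ℝ] ℝ} {g g' : ι → ℝ → ℝ} {κ : ι → ℝ}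
    (hg : ∀ i t, HasDerivAt (g i) (g' i t) t) (hκ : ∀ i t, κ i ≤ g' i t) (hκ0 : ∀ i, 0 ≤ κ i)
    (hsep : ∀ x, (∀ i, κ i * ℓ i x = 0) → x = 0) :
    Function.Injective fun x => ∑ i, g i (ℓ i x) • ℓ i := by
  intro x x' h
  refine sub_eq_zero.1 (eq_zero_of_sum_nonpos hκ0 hsep ?_)
  have h1 : ∑ i, (g i (ℓ i x) - g i (ℓ i x')) * (ℓ i x - ℓ i x') = 0 := by
    have := congrArg (fun u : V →L[ℝ] ℝ => u (x - x')) h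
    simp only [sum_apply, smul_apply, smul_eq_mul] at this
    simp only [← map_sub]
    simp only [sub_mul, Finset.sum_sub_distrib, this, sub_self]
  rw [← h1]
  refine Finset.sum_le_sum fun i _ => ?_
  rw [map_sub]
  exact mul_sq_le_of_le_deriv (hg i) (hκ i) _ _

/-- The linear map `x ↦ (√κ_i ℓ_i x)_i` is injective, hence antilipschitz in finite dimension. -/
theorem exists_mul_norm_sq_le [FiniteDimensional ℝ V] {ℓ : ι → V →L[ℝ] ℝ} {κ : ι → ℝ}
    (hκ0 : ∀ i, 0 ≤ κ i) (hsep : ∀ x, (∀ i, κ i * ℓ i x = 0) → x = 0) :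
    ∃ c > 0, ∀ x, c * ‖x‖ ^ 2 ≤ ∑ i, κ i * ℓ i x ^ 2 := by
  let T : V →ₗ[ℝ] (ι → ℝ) := LinearMap.pi fun i => (√(κ i) • ℓ i : V →L[ℝ] ℝ).toLinearMap
  have hT : LinearMap.ker T = ⊥ := by
    refine LinearMap.ker_eq_bot'.2 fun x hx => hsep x fun i => ?_
    have : √(κ i) * ℓ i x = 0 := congrFun hx i
    rw [← Real.mul_self_sqrt (hκ0 i), mul_assoc, this, mul_zero]
  obtain ⟨C, hC, hT⟩ := T.exists_antilipschitzWith hT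
  have hC' : (0 : ℝ) < C := hC
  refine ⟨(C ^ 2 : ℝ)⁻¹, by positivity, fun x => ?_⟩
  have hQ : 0 ≤ ∑ i, κ i * ℓ i x ^ 2 :=
    Finset.sum_nonneg fun i _ => mul_nonneg (hκ0 i) (sq_nonneg _)
  have h1 : ‖T x‖ ≤ √(∑ i, κ i * ℓ i x ^ 2) := by
    refine (pi_norm_le_iff_of_nonneg (Real.sqrt_nonneg _)).2 fun i => Real.abs_le_sqrt ?_
    have : (T x i) ^ 2 = κ i * ℓ i x ^ 2 := by
      change (√(κ i) * ℓ i x) ^ 2 = _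
      rw [mul_pow, Real.sq_sqrt (hκ0 i)]
    rw [this]
    exact Finset.single_le_sum (f := fun i => κ i * ℓ i x ^ 2)
      (fun i _ => mul_nonneg (hκ0 i) (sq_nonneg _)) (Finset.mem_univ i)
  have h2 : ‖x‖ ≤ C * ‖T x‖ := by simpa using hT.le_mul_dist x 0
  have h3 : ‖x‖ ≤ C * √(∑ i, κ i * ℓ i x ^ 2) := h2.trans (by gcongr)
  rw [inv_mul_le_iff₀ (by positivity)]
  calc ‖x‖ ^ 2 ≤ (C * √(∑ i, κ i * ℓ i x ^ 2)) ^ 2 := by gcongr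
    _ = _ := by rw [mul_pow, Real.sq_sqrt hQ]

/-- The equation says that `x` is a critical point of `∑ Φ_i(ℓ_i x) - y x`. The quadratic lower
bound makes this function coercive, so it has a minimum. -/
theorem surjective_sum_smul [FiniteDimensional ℝ V] {ℓ : ι → V →L[ℝ] ℝ} {Φ g : ι → ℝ → ℝ}
    {κ : ι → ℝ} (hΦ : ∀ i t, HasDerivAt (Φ i) (g i t) t) (hκ : ∀ i t, κ i * t ^ 2 ≤ Φ i t)
    (hκ0 : ∀ i, 0 ≤ κ i) (hsep : ∀ x, (∀ i, κ i * ℓ i x = 0) → x = 0) :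
    Function.Surjective fun x => ∑ i, g i (ℓ i x) • ℓ i := by
  intro y
  have hd : ∀ x, HasFDerivAt (fun x => ∑ i, Φ i (ℓ i x) - y x)
      (∑ i, g i (ℓ i x) • ℓ i - y) x := fun x =>
    (HasFDerivAt.fun_sum fun i _ => (hΦ i _).comp_hasFDerivAt x (ℓ i).hasFDerivAt).sub
      y.hasFDerivAt
  obtain ⟨c, hc, hle⟩ := exists_mul_norm_sq_le hκ0 hsep
  have hlim : Filter.Tendsto (fun x => ∑ i, Φ i (ℓ i x) - y x) (Filter.cocompact V)
      Filter.atTop := by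
    have h1 : Filter.Tendsto (fun t : ℝ => t * (c * t - ‖y‖)) Filter.atTop Filter.atTop :=
      Filter.tendsto_id.atTop_mul_atTop₀
        (Filter.tendsto_atTop_add_const_right _ _ (Filter.tendsto_id.const_mul_atTop hc))
    refine Filter.tendsto_atTop_mono (fun x => ?_)
      (h1.comp (tendsto_norm_cocompact_atTop (E := V)))
    have h2 : ∑ i, κ i * ℓ i x ^ 2 ≤ ∑ i, Φ i (ℓ i x) :=
      Finset.sum_le_sum fun i _ => hκ i _
    have h3 : y x ≤ ‖y‖ * ‖x‖ := (le_abs_self _).trans (y.le_opNorm x)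
    have h4 := hle x
    simp only [Function.comp_apply]
    nlinarith
  obtain ⟨x, hx⟩ := (continuous_iff_continuousAt.2 fun x => (hd x).continuousAt).exists_forall_le
    hlim
  have hmin : IsLocalMin (fun x => ∑ i, Φ i (ℓ i x) - y x) x := Filter.Eventually.of_forall hx
  exact ⟨x, sub_eq_zero.1 (hmin.hasFDerivAt_eq_zero (hd x))⟩

end Monotone

/-! ### Hyperbolic estimates for one coordinate -/

section Profile

/-- The function `t ↦ h cosh (2t) + (r / 2) sinh (2t)`. -/
noncomputable def profile (h r t : ℝ) : ℝ := h * Real.cosh (2 * t) + r / 2 * Real.sinh (2 * t)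

theorem hasDerivAt_profile (h r t : ℝ) :
    HasDerivAt (profile h r) (2 * h * Real.sinh (2 * t) + r * Real.cosh (2 * t)) t := by
  have h2 : HasDerivAt (fun t : ℝ => 2 * t) 2 t := by
    simpa using (hasDerivAt_id t).const_mul (2 : ℝ)
  convert! (h2.cosh.const_mul h).add (h2.sinh.const_mul (r / 2)) using 1
  ring

theorem hasDerivAt_profile_primitive (h r t : ℝ) :
    HasDerivAt (fun t => h / 2 * Real.sinh (2 * t) + r / 4 * Real.cosh (2 * t)) (profile h r t)
      t := by
  have h2 : HasDerivAt (fun t : ℝ => 2 * t) 2 t := by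
    simpa using (hasDerivAt_id t).const_mul (2 : ℝ)
  convert! (h2.sinh.const_mul (h / 2)).add (h2.cosh.const_mul (r / 4)) using 1
  simp only [profile]; ring

theorem sub_abs_mul_cosh_le (h r t : ℝ) :
    (r - 2 * |h|) * Real.cosh t ≤ 2 * h * Real.sinh t + r * Real.cosh t := by
  have h1 : |Real.sinh t| ≤ Real.cosh t := by
    rw [Real.abs_sinh, ← Real.cosh_abs]
    exact (Real.sinh_lt_cosh _).le
  have h2 : |h * Real.sinh t| ≤ |h| * Real.cosh t := by
    rw [abs_mul]; gcongr
  nlinarith [neg_abs_le (h * Real.sinh t)]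

theorem sub_abs_le_deriv_profile {h r : ℝ} (hr : 2 * |h| ≤ r) (t : ℝ) :
    r - 2 * |h| ≤ 2 * h * Real.sinh (2 * t) + r * Real.cosh (2 * t) :=
  (le_mul_of_one_le_right (by linarith) (Real.one_le_cosh _)).trans (sub_abs_mul_cosh_le h r _)

/-- Coercivity of the potential, from `cosh 2t = 1 + 2 sinh² t ≥ 2t²`. -/
theorem sq_le_profile_primitive {h r : ℝ} (hr : 2 * |h| ≤ r) (t : ℝ) :
    (r - 2 * |h|) / 2 * t ^ 2 ≤ h / 2 * Real.sinh (2 * t) + r / 4 * Real.cosh (2 * t) := by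
  have h1 := sub_abs_mul_cosh_le h r (2 * t)
  have h2 : t ^ 2 ≤ Real.sinh t ^ 2 := by
    rw [sq_le_sq, Real.abs_sinh]
    exact Real.self_le_sinh_iff.2 (abs_nonneg t)
  have h3 : 2 * t ^ 2 ≤ Real.cosh (2 * t) := by
    rw [Real.cosh_two_mul, Real.cosh_sq]; linarith
  nlinarith [mul_le_mul_of_nonneg_left h3 (by linarith : 0 ≤ r - 2 * |h|)]

end Profile

/-! ### The hyperbolic action and its invariants -/

section Push

open ComplexConjugate

variable {N : ℕ} {V : Type*} [NormedAddCommGroup V] [NormedSpace ℝ V]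

/-- The real moment map `|z_i|² - |w_i|²` of the `i`-th coordinate circle. -/
noncomputable def normDiff (p : HN N) (i : Fin N) : ℝ := ‖p.1 i‖ ^ 2 - ‖p.2 i‖ ^ 2

/-- The squared norm `|z_i|² + |w_i|²` of the `i`-th quaternionic coordinate. -/
noncomputable def normSum (p : HN N) (i : Fin N) : ℝ := ‖p.1 i‖ ^ 2 + ‖p.2 i‖ ^ 2

/-- The component `Re (ē z_i w_i)` of the complex moment map of the `i`-th coordinate circle. -/
noncomputable def rePart (e : ℂ) (p : HN N) (i : Fin N) : ℝ := (conj e * (p.1 i * p.2 i)).re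

/-- The action of `exp (√-1 x)`, `x ∈ k`, for the complexification of the torus action with respect
to the complex structure determined by the unit complex number `e`. -/
noncomputable def push (ℓ : Fin N → V →L[ℝ] ℝ) (e : ℂ) (x : V) (p : HN N) : HN N :=
  (fun i => (Real.cosh (ℓ i x) : ℂ) * p.1 i + (Real.sinh (ℓ i x) : ℂ) * (e * conj (p.2 i)),
   fun i => (Real.cosh (ℓ i x) : ℂ) * p.2 i + (Real.sinh (ℓ i x) : ℂ) * (e * conj (p.1 i)))

theorem conj_mul_mul_push {ℓ : Fin N → V →L[ℝ] ℝ} {e : ℂ} (he : e * conj e = 1) (x : V)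
    (p : HN N) (i : Fin N) :
    conj e * ((push ℓ e x p).1 i * (push ℓ e x p).2 i) =
      (Real.cosh (ℓ i x) ^ 2 : ℝ) * (conj e * (p.1 i * p.2 i)) +
      (Real.sinh (ℓ i x) ^ 2 : ℝ) * conj (conj e * (p.1 i * p.2 i)) +
      (Real.cosh (ℓ i x) * Real.sinh (ℓ i x) * normSum p i : ℝ) := by
  have h1 := Complex.mul_conj' (p.1 i)
  have h2 := Complex.mul_conj' (p.2 i)
  simp only [push, normSum, Complex.ofReal_mul, Complex.ofReal_add, Complex.ofReal_pow, map_mul,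
    Complex.conj_conj, ← h1, ← h2]
  linear_combination
    ((Real.cosh (ℓ i x) : ℂ) * Real.sinh (ℓ i x) * (p.1 i * conj (p.1 i) + p.2 i * conj (p.2 i)) +
      (Real.sinh (ℓ i x) : ℂ) ^ 2 * e * conj (p.1 i) * conj (p.2 i)) * he

theorem rePart_push {ℓ : Fin N → V →L[ℝ] ℝ} {e : ℂ} (he : e * conj e = 1) (x : V)
    (p : HN N) (i : Fin N) :
    rePart e (push ℓ e x p) i = profile (rePart e p i) (normSum p i) (ℓ i x) := by
  rw [rePart, conj_mul_mul_push he, Complex.add_re, Complex.add_re, Complex.re_ofReal_mul,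
    Complex.re_ofReal_mul, Complex.conj_re, Complex.ofReal_re, profile, Real.cosh_two_mul,
    Real.sinh_two_mul, rePart]
  ring

/-- Conjugation flips the imaginary part of the second term, so the factor is `cosh² - sinh² = 1`.
-/
theorem im_push {ℓ : Fin N → V →L[ℝ] ℝ} {e : ℂ} (he : e * conj e = 1) (x : V)
    (p : HN N) (i : Fin N) :
    (conj e * ((push ℓ e x p).1 i * (push ℓ e x p).2 i)).im = (conj e * (p.1 i * p.2 i)).im := by
  rw [conj_mul_mul_push he, Complex.add_im, Complex.add_im, Complex.im_ofReal_mul,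
    Complex.im_ofReal_mul, Complex.conj_im, Complex.ofReal_im, Real.cosh_sq]
  ring

theorem rePart_I_push_one (ℓ : Fin N → V →L[ℝ] ℝ) (x : V) (p : HN N) :
    rePart Complex.I (push ℓ 1 x p) = rePart Complex.I p := by
  funext i
  simpa [rePart] using im_push (ℓ := ℓ) (e := 1) (by simp) x p i

theorem rePart_one_push_I (ℓ : Fin N → V →L[ℝ] ℝ) (x : V) (p : HN N) :
    rePart 1 (push ℓ Complex.I x p) = rePart 1 p := by
  funext i
  have h := im_push (ℓ := ℓ) (e := Complex.I) (by simp) x p i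
  simp only [Complex.conj_I, neg_mul, Complex.neg_im, Complex.I_mul_im, neg_inj] at h
  simpa only [rePart, map_one, one_mul] using h

/-- `push` is a hyperbolic rotation of each pair `(z_i, e w̄_i)`, and `|e w̄_i| = |w_i|`. -/
theorem normDiff_push {ℓ : Fin N → V →L[ℝ] ℝ} {e : ℂ} (he : e * conj e = 1) (x : V)
    (p : HN N) : normDiff (push ℓ e x p) = normDiff p := by
  funext i
  have hc : (Real.cosh (ℓ i x) : ℂ) ^ 2 = Real.sinh (ℓ i x) ^ 2 + 1 := by
    exact_mod_cast Real.cosh_sq (ℓ i x)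
  apply Complex.ofReal_injective
  simp only [normDiff, Complex.ofReal_sub, Complex.ofReal_pow, ← Complex.mul_conj', push, map_add,
    map_mul, Complex.conj_conj, Complex.conj_ofReal]
  linear_combination
    (p.1 i * conj (p.1 i) - p.2 i * conj (p.2 i)) * hc +
    (Real.sinh (ℓ i x) : ℂ) ^ 2 * (p.2 i * conj (p.2 i) - p.1 i * conj (p.1 i)) * he

theorem push_zero (ℓ : Fin N → V →L[ℝ] ℝ) (e : ℂ) (p : HN N) : push ℓ e 0 p = p := by
  ext i <;> simp [push]

theorem push_add {ℓ : Fin N → V →L[ℝ] ℝ} {e : ℂ} (he : e * conj e = 1) (x y : V)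
    (p : HN N) : push ℓ e (x + y) p = push ℓ e x (push ℓ e y p) := by
  ext i
  · simp only [push, map_add, map_mul, Complex.conj_conj, Complex.conj_ofReal, Real.cosh_add,
      Real.sinh_add, Complex.ofReal_add, Complex.ofReal_mul]
    linear_combination
      -((Real.sinh (ℓ i x) : ℂ) * Real.sinh (ℓ i y) * p.1 i) * he
  · simp only [push, map_add, map_mul, Complex.conj_conj, Complex.conj_ofReal, Real.cosh_add,
      Real.sinh_add, Complex.ofReal_add, Complex.ofReal_mul]
    linear_combination
      -((Real.sinh (ℓ i x) : ℂ) * Real.sinh (ℓ i y) * p.2 i) * he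

theorem push_act (ℓ : Fin N → V →L[ℝ] ℝ) (e : ℂ) (x : V) (ζ : Torus N) (p : HN N) :
    push ℓ e x (act ζ p) = act ζ (push ℓ e x p) := by
  ext i <;> simp only [push, act, map_mul, ← Circle.coe_inv_eq_conj, inv_inv] <;> ring

theorem act_fst_mul_snd (ζ : Torus N) (p : HN N) (i : Fin N) :
    (act ζ p).1 i * (act ζ p).2 i = p.1 i * p.2 i := by
  have : (ζ i : ℂ) * ((ζ i)⁻¹ : Circle) = 1 := by simp
  simp only [act]
  linear_combination p.1 i * p.2 i * this

theorem rePart_act (e : ℂ) (ζ : Torus N) (p : HN N) : rePart e (act ζ p) = rePart e p := by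
  funext i; simp only [rePart, act_fst_mul_snd]

theorem two_mul_abs_rePart_le {e : ℂ} (he : ‖e‖ = 1) (p : HN N) (i : Fin N) :
    2 * |rePart e p i| ≤ 2 * (‖p.1 i‖ * ‖p.2 i‖) := by
  have := Complex.abs_re_le_norm (conj e * (p.1 i * p.2 i))
  rw [norm_mul, norm_mul, Complex.norm_conj, he, one_mul] at this
  exact mul_le_mul_of_nonneg_left this zero_le_two

theorem two_mul_abs_rePart_le_normSum {e : ℂ} (he : ‖e‖ = 1) (p : HN N) (i : Fin N) :
    2 * |rePart e p i| ≤ normSum p i :=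
  (two_mul_abs_rePart_le he p i).trans (by
    simp only [normSum]; nlinarith [sq_nonneg (‖p.1 i‖ - ‖p.2 i‖)])

/-- Equality in `2|z_i||w_i| ≤ |z_i|² + |w_i|²` forces `|z_i| = |w_i|`. Thus the convexity constant
`r - 2|h|` degenerates only where `normDiff` vanishes. -/
theorem normDiff_eq_zero_of_normSum_le {e : ℂ} (he : ‖e‖ = 1) {p : HN N} {i : Fin N}
    (h : normSum p i - 2 * |rePart e p i| = 0) : normDiff p i = 0 := by
  have h1 := two_mul_abs_rePart_le he p i
  simp only [normSum] at h
  have h2 : (‖p.1 i‖ - ‖p.2 i‖) ^ 2 = 0 := le_antisymm (by nlinarith) (sq_nonneg _)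
  rw [normDiff, sub_eq_zero.1 (pow_eq_zero_iff two_ne_zero |>.1 h2), sub_self]

theorem contDiff_rePart (e : ℂ) (i : Fin N) : ContDiff ℝ ∞ fun p : HN N => rePart e p i := by
  have h : ContDiff ℝ ∞ fun p : HN N => conj e * (p.1 i * p.2 i) := by fun_prop
  exact Complex.reCLM.contDiff.comp h

theorem contDiff_push (ℓ : Fin N → V →L[ℝ] ℝ) (e : ℂ) :
    ContDiff ℝ ∞ fun u : V × HN N => push ℓ e u.1 u.2 := by
  have hch : ∀ i, ContDiff ℝ ∞ fun u : V × HN N => (Real.cosh (ℓ i u.1) : ℂ) := fun i =>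
    Complex.ofRealCLM.contDiff.comp ((ℓ i).contDiff.comp contDiff_fst).cosh
  have hsh : ∀ i, ContDiff ℝ ∞ fun u : V × HN N => (Real.sinh (ℓ i u.1) : ℂ) := fun i =>
    Complex.ofRealCLM.contDiff.comp ((ℓ i).contDiff.comp contDiff_fst).sinh
  have hz : ∀ i, ContDiff ℝ ∞ fun u : V × HN N => u.2.1 i := fun i => by fun_prop
  have hw : ∀ i, ContDiff ℝ ∞ fun u : V × HN N => u.2.2 i := fun i => by fun_prop
  have hcj : ∀ {f : V × HN N → ℂ}, ContDiff ℝ ∞ f → ContDiff ℝ ∞ fun u => conj (f u) :=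
    fun hf => Complex.conjCLE.contDiff.comp hf
  refine ContDiff.prodMk (contDiff_pi.2 fun i => ?_) (contDiff_pi.2 fun i => ?_)
  · exact ((hch i).mul (hz i)).add ((hsh i).mul (contDiff_const.mul (hcj (hw i))))
  · exact ((hch i).mul (hw i)).add ((hsh i).mul (contDiff_const.mul (hcj (hz i))))

end Push

/-! ### Sliding along orbits to a prescribed moment value -/

section Slide

variable {N : ℕ} {V : Type*} [NormedAddCommGroup V] [NormedSpace ℝ V]

/-- The component of the complex moment map in the direction of the unit complex number `e`. -/
noncomputable def reMoment (ℓ : Fin N → V →L[ℝ] ℝ) (e : ℂ) (p : HN N) : V →L[ℝ] ℝ :=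
  ∑ i, rePart e p i • ℓ i

/-- The points at which the forms `ℓ i` with `|z_i|² ≠ |w_i|²` span the dual of `V`. -/
def spanningLocus (ℓ : Fin N → V →L[ℝ] ℝ) : Set (HN N) :=
  {p | ∀ x, (∀ i, normDiff p i ≠ 0 → ℓ i x = 0) → x = 0}

theorem isOpen_spanningLocus (ℓ : Fin N → V →L[ℝ] ℝ) : IsOpen (spanningLocus ℓ) := by
  refine isOpen_iff_eventually.2 fun p hp => ?_
  have h : ∀ᶠ q in 𝓝 p, ∀ i, normDiff p i ≠ 0 → normDiff q i ≠ 0 := by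
    refine Filter.eventually_all.2 fun i => ?_
    by_cases hi : normDiff p i = 0
    · simp [hi]
    · have hc : Continuous fun q : HN N => normDiff q i := by unfold normDiff; fun_prop
      exact (hc.continuousAt.eventually_ne hi).mono fun q hq _ => hq
  exact h.mono fun q hq x hx => hp x fun i hi => hx i (hq i hi)

theorem eq_zero_of_mem_spanningLocus {ℓ : Fin N → V →L[ℝ] ℝ} {e : ℂ} (he : ‖e‖ = 1) {p : HN N}
    (hp : p ∈ spanningLocus ℓ) (x : V)
    (hx : ∀ i, (normSum p i - 2 * |rePart e p i|) * ℓ i x = 0) : x = 0 :=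
  hp x fun i hi =>
    (mul_eq_zero.1 (hx i)).resolve_left fun h => hi (normDiff_eq_zero_of_normSum_le he h)

theorem reMoment_push {ℓ : Fin N → V →L[ℝ] ℝ} {e : ℂ} (he : e * starRingEnd ℂ e = 1) (x : V)
    (p : HN N) :
    reMoment ℓ e (push ℓ e x p) = ∑ i, profile (rePart e p i) (normSum p i) (ℓ i x) • ℓ i := by
  simp only [reMoment, rePart_push he]

theorem norm_eq_one_of_mul_conj {e : ℂ} (he : e * starRingEnd ℂ e = 1) : ‖e‖ = 1 := by
  rw [Complex.mul_conj'] at he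
  have : ‖e‖ ^ 2 = 1 := by exact_mod_cast he
  exact (pow_eq_one_iff_of_nonneg (norm_nonneg e) two_ne_zero).1 this

theorem injective_reMoment_push {ℓ : Fin N → V →L[ℝ] ℝ} {e : ℂ} (he : e * starRingEnd ℂ e = 1)
    {p : HN N} (hp : p ∈ spanningLocus ℓ) :
    Function.Injective fun x => reMoment ℓ e (push ℓ e x p) := by
  have hn := norm_eq_one_of_mul_conj he
  simp only [reMoment_push he]
  exact injective_sum_smul (fun i t => hasDerivAt_profile _ _ t)
    (fun i t => sub_abs_le_deriv_profile (two_mul_abs_rePart_le_normSum hn p i) t)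
    (fun i => sub_nonneg.2 (two_mul_abs_rePart_le_normSum hn p i))
    (eq_zero_of_mem_spanningLocus hn hp)

theorem surjective_reMoment_push [FiniteDimensional ℝ V] {ℓ : Fin N → V →L[ℝ] ℝ} {e : ℂ}
    (he : e * starRingEnd ℂ e = 1) {p : HN N} (hp : p ∈ spanningLocus ℓ) :
    Function.Surjective fun x => reMoment ℓ e (push ℓ e x p) := by
  have hn := norm_eq_one_of_mul_conj he
  simp only [reMoment_push he]
  refine surjective_sum_smul (κ := fun i => (normSum p i - 2 * |rePart e p i|) / 2)
    (fun i t => hasDerivAt_profile_primitive _ _ t)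
    (fun i t => sq_le_profile_primitive (two_mul_abs_rePart_le_normSum hn p i) t)
    (fun i => ?_) fun x hx => eq_zero_of_mem_spanningLocus hn hp x fun i => ?_
  · have := two_mul_abs_rePart_le_normSum hn p i
    linarith
  · linear_combination 2 * hx i

/-- The parameter `x` for which `push ℓ e x p` has `e`-component of the moment map equal to `y`. -/
noncomputable def slideParam (ℓ : Fin N → V →L[ℝ] ℝ) (e : ℂ) (p : HN N) (y : V →L[ℝ] ℝ) : V :=
  Function.invFun (fun x => reMoment ℓ e (push ℓ e x p)) y

theorem slideParam_eq {ℓ : Fin N → V →L[ℝ] ℝ} {e : ℂ} (he : e * starRingEnd ℂ e = 1)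
    {p : HN N} (hp : p ∈ spanningLocus ℓ) {x : V} {y : V →L[ℝ] ℝ}
    (h : reMoment ℓ e (push ℓ e x p) = y) : slideParam ℓ e p y = x := by
  rw [← h]
  exact Function.leftInverse_invFun (injective_reMoment_push he hp) x

/-- The point `push ℓ e x p` of the orbit of `p` with `e`-component of the moment map `y`. -/
noncomputable def slide (ℓ : Fin N → V →L[ℝ] ℝ) (e : ℂ) (p : HN N) (y : V →L[ℝ] ℝ) : HN N :=
  push ℓ e (slideParam ℓ e p y) p

theorem reMoment_slide [FiniteDimensional ℝ V] {ℓ : Fin N → V →L[ℝ] ℝ} {e : ℂ}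
    (he : e * starRingEnd ℂ e = 1) {p : HN N} (hp : p ∈ spanningLocus ℓ) (y : V →L[ℝ] ℝ) :
    reMoment ℓ e (slide ℓ e p y) = y :=
  Function.invFun_eq (surjective_reMoment_push he hp y)

theorem normDiff_slide {ℓ : Fin N → V →L[ℝ] ℝ} {e : ℂ} (he : e * starRingEnd ℂ e = 1)
    (p : HN N) (y : V →L[ℝ] ℝ) : normDiff (slide ℓ e p y) = normDiff p :=
  normDiff_push he _ p

theorem slide_mem_spanningLocus {ℓ : Fin N → V →L[ℝ] ℝ} {e : ℂ} (he : e * starRingEnd ℂ e = 1)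
    {p : HN N} (hp : p ∈ spanningLocus ℓ) (y : V →L[ℝ] ℝ) :
    slide ℓ e p y ∈ spanningLocus ℓ := by
  simpa only [spanningLocus, Set.mem_ofPred_eq, normDiff_slide he] using hp

/-- The torus commutes with `push` and fixes `rePart`, so both points solve the same equation for
the parameter, on or off the spanning locus. -/
theorem slide_act (ℓ : Fin N → V →L[ℝ] ℝ) (e : ℂ) (ζ : Torus N) (p : HN N) (y : V →L[ℝ] ℝ) :
    slide ℓ e (act ζ p) y = act ζ (slide ℓ e p y) := by
  have h : slideParam ℓ e (act ζ p) y = slideParam ℓ e p y := by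
    simp only [slideParam, push_act, reMoment, rePart_act]
  rw [slide, slide, h, push_act]

theorem slide_self {ℓ : Fin N → V →L[ℝ] ℝ} {e : ℂ} (he : e * starRingEnd ℂ e = 1)
    {p : HN N} (hp : p ∈ spanningLocus ℓ) : slide ℓ e p (reMoment ℓ e p) = p := by
  rw [slide, slideParam_eq he hp (x := 0) (by rw [push_zero]), push_zero]

/-- `push` is a group action, and the result is the unique point of the orbit with moment value
`y'`, whatever the starting point. -/
theorem slide_slide [FiniteDimensional ℝ V] {ℓ : Fin N → V →L[ℝ] ℝ} {e : ℂ}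
    (he : e * starRingEnd ℂ e = 1) {p : HN N} (hp : p ∈ spanningLocus ℓ) (y y' : V →L[ℝ] ℝ) :
    slide ℓ e (slide ℓ e p y) y' = slide ℓ e p y' := by
  have h := reMoment_slide he (slide_mem_spanningLocus he hp y) y'
  simp only [slide] at h ⊢
  rw [← push_add he] at h ⊢
  rw [slideParam_eq he hp h]

theorem slide_slide_eq_self [FiniteDimensional ℝ V] {ℓ : Fin N → V →L[ℝ] ℝ} {e : ℂ}
    (he : e * starRingEnd ℂ e = 1) {p : HN N} (hp : p ∈ spanningLocus ℓ) {y y' : V →L[ℝ] ℝ}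
    (h : reMoment ℓ e p = y') : slide ℓ e (slide ℓ e p y) y' = p := by
  rw [slide_slide he hp, ← h, slide_self he hp]

theorem contDiff_reMoment (ℓ : Fin N → V →L[ℝ] ℝ) (e : ℂ) : ContDiff ℝ ∞ (reMoment ℓ e) :=
  ContDiff.sum fun i _ => (contDiff_rePart e i).smul contDiff_const

/-- Implicit function theorem: the partial derivative in `x` is the Hessian of the potential, which
is positive definite on the spanning locus. -/
theorem contDiffAt_slideParam [FiniteDimensional ℝ V] {ℓ : Fin N → V →L[ℝ] ℝ} {e : ℂ}
    (he : e * starRingEnd ℂ e = 1) {p : HN N} (hp : p ∈ spanningLocus ℓ) (y : V →L[ℝ] ℝ) :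
    ContDiffAt ℝ ∞ (fun u : HN N × (V →L[ℝ] ℝ) => slideParam ℓ e u.1 u.2) (p, y) := by
  have hn := norm_eq_one_of_mul_conj he
  have : CompleteSpace V := FiniteDimensional.complete ℝ V
  set x := slideParam ℓ e p y with hx
  let f : (HN N × (V →L[ℝ] ℝ)) × V → (V →L[ℝ] ℝ) :=
    fun u => reMoment ℓ e (push ℓ e u.2 u.1.1) - u.1.2
  have hf : ContDiff ℝ ∞ f :=
    ((contDiff_reMoment ℓ e).comp ((contDiff_push ℓ e).comp
      (contDiff_snd.prodMk (contDiff_fst.comp contDiff_fst)))).sub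
      (contDiff_snd.comp contDiff_fst)
  have hf0 : f ((p, y), x) = 0 := sub_eq_zero.2 (reMoment_slide he hp y)
  let D : V →L[ℝ] (V →L[ℝ] ℝ) := fderiv ℝ f ((p, y), x) ∘L .inr ℝ _ V
  have hD : HasFDerivAt (fun x' => f ((p, y), x')) D x := by
    have h1 := (hf.differentiable (by simp) ((p, y), x)).hasFDerivAt
    exact h1.comp x (hasFDerivAt_prodMk_right (p, y) x)
  have hD' : HasFDerivAt (fun x' => f ((p, y), x'))
      (∑ i, ((2 * rePart e p i * Real.sinh (2 * ℓ i x) + normSum p i * Real.cosh (2 * ℓ i x)) •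
        ℓ i).smulRight (ℓ i)) x := by
    simp only [f, reMoment_push he]
    exact (HasFDerivAt.fun_sum fun i _ => ((hasDerivAt_profile _ _ _).comp_hasFDerivAt x
      (ℓ i).hasFDerivAt).smul_const (ℓ i)).sub_const y
  have hinj : Function.Injective D := by
    -- Evaluating `D v` at `v` gives the Hessian quadratic form, bounded below by `∑ (r - 2|h|) (ℓ_i
    -- v)²`.
    refine (injective_iff_map_eq_zero D).2 fun v hv => ?_
    refine eq_zero_of_sum_nonpos
      (fun i => sub_nonneg.2 (two_mul_abs_rePart_le_normSum hn p i))
      (eq_zero_of_mem_spanningLocus hn hp) ?_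
    have h0 := congrArg (fun u : V →L[ℝ] ℝ => u v) (hD.unique hD' ▸ hv)
    simp only [sum_apply, ContinuousLinearMap.smulRight_apply, smul_apply, smul_eq_mul,
      zero_apply] at h0
    rw [← h0]
    refine Finset.sum_le_sum fun i _ => ?_
    rw [mul_assoc _ (ℓ i v), ← sq]
    exact mul_le_mul_of_nonneg_right
      (sub_abs_le_deriv_profile (two_mul_abs_rePart_le_normSum hn p i) _) (sq_nonneg _)
  have hfin : Module.finrank ℝ V = Module.finrank ℝ (V →L[ℝ] ℝ) := by
    rw [← (LinearMap.toContinuousLinearMap (𝕜 := ℝ) (E := V) (F' := ℝ)).finrank_eq]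
    exact (Subspace.dual_finrank_eq (K := ℝ) (V := V)).symm
  have hinv : D.IsInvertible :=
    ⟨(LinearEquiv.ofInjectiveOfFinrankEq D.toLinearMap hinj hfin).toContinuousLinearEquiv,
      ContinuousLinearMap.ext fun _ => rfl⟩
  have hψ := hf.contDiffAt.contDiffAt_implicitFunction (by simp) hinv
  refine hψ.congr_of_eventuallyEq ?_
  -- At nearby points, still in the open spanning locus, the solution is unique, so the local
  -- implicit function agrees with `slideParam`.
  have hU : ∀ᶠ u : HN N × (V →L[ℝ] ℝ) in 𝓝 (p, y), u.1 ∈ spanningLocus ℓ :=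
    continuousAt_fst.eventually ((isOpen_spanningLocus ℓ).eventually_mem hp)
  filter_upwards [hU, hf.contDiffAt.eventually_apply_implicitFunction (by simp) hinv]
    with u hu hψu
  exact slideParam_eq he hu (sub_eq_zero.1 (hψu.trans hf0))

theorem contDiffOn_slide [FiniteDimensional ℝ V] {ℓ : Fin N → V →L[ℝ] ℝ} {e : ℂ}
    (he : e * starRingEnd ℂ e = 1) {E : Type*} [NormedAddCommGroup E] [NormedSpace ℝ E]
    {s : Set E} {f : E → HN N} {g : E → V →L[ℝ] ℝ} (hf : ContDiffOn ℝ ∞ f s)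
    (hg : ContDiffOn ℝ ∞ g s) (hs : ∀ u ∈ s, f u ∈ spanningLocus ℓ) :
    ContDiffOn ℝ ∞ (fun u => slide ℓ e (f u) (g u)) s := fun u hu =>
  have h : ContDiffWithinAt ℝ ∞ (fun u => slideParam ℓ e (f u) (g u)) s u :=
    ContDiffAt.comp_contDiffWithinAt (f := fun x => (f x, g x))
      (g := fun x : HN N × (V →L[ℝ] ℝ) => slideParam ℓ e x.1 x.2) u
      (contDiffAt_slideParam he (hs u hu) (g u)) ((hf u hu).prodMk (hg u hu))
  ContDiffAt.comp_contDiffWithinAt (f := fun x => (slideParam ℓ e (f x) (g x), f x))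
    (g := fun x : V × HN N => push ℓ e x.1 x.2) u (contDiff_push ℓ e).contDiffAt
    (h.prodMk (hf u hu))

end Slide

/-! ### Quotients of products and homotopy -/

section Quotient

variable {A B C : Type*} [TopologicalSpace A] [TopologicalSpace B] [TopologicalSpace C]
  [LocallyCompactSpace C]

/-- A homeomorphism `A ≃ B × C` matching an equivalence relation on `A` with one on `B` descends to
the quotients. -/
def quotientHomeomorphProd (sA : Setoid A) (sB : Setoid B) (e : A ≃ₜ B × C)
    (h : ∀ a a', sA a a' ↔ sB (e a).1 (e a').1 ∧ (e a).2 = (e a').2) :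
    Quotient sA ≃ₜ Quotient sB × C where
  toFun := Quotient.lift (fun a => (Quotient.mk sB (e a).1, (e a).2)) fun a a' haa' =>
    Prod.ext (Quotient.sound ((h a a').1 haa').1) ((h a a').1 haa').2
  invFun x := Quotient.lift (fun b => Quotient.mk sA (e.symm (b, x.2))) (fun b b' hbb' =>
    Quotient.sound ((h _ _).2 (by simpa using hbb'))) x.1
  left_inv := by
    rintro ⟨a⟩
    exact congrArg (Quotient.mk sA) (e.symm_apply_apply a)
  right_inv := by
    rintro ⟨⟨b⟩, c⟩
    refine Prod.ext (congrArg (Quotient.mk sB) ?_) ?_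
    · exact congrArg Prod.fst (e.apply_symm_apply (b, c))
    · change (e (e.symm (b, c))).2 = c
      rw [e.apply_symm_apply]
  continuous_toFun := Continuous.quotient_lift
    ((continuous_quotient_mk'.comp (continuous_fst.comp e.continuous)).prodMk
      (continuous_snd.comp e.continuous)) _
  -- Local compactness of `C` keeps the quotient map a quotient map after taking the product with
  -- `C`.
  continuous_invFun := (isQuotientMap_quotient_mk' (s := sB)).continuous_lift_prod_left
    (continuous_quotient_mk'.comp e.symm.continuous)

/-- A product with a contractible space is homotopy equivalent to the other factor. -/
theorem nonempty_homotopyEquiv_prod_of_contractible (B C : Type*) [TopologicalSpace B]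
    [TopologicalSpace C] [ContractibleSpace C] :
    Nonempty (ContinuousMap.HomotopyEquiv B (B × C)) := by
  obtain ⟨e⟩ := ContractibleSpace.hequiv_unit C
  exact ⟨(Homeomorph.prodUnique B Unit).symm.toHomotopyEquiv.trans
    ((ContinuousMap.HomotopyEquiv.refl B).prodCongr e.symm)⟩

end Quotient

/-! ### Moment map components and the consequence of regularity -/

section Moment

variable {N : ℕ} (K : Subgroup (Torus N))

theorem mu1_apply (p : HN N) (x : Lie K) :
    mu1 K p x = Real.pi * ∑ i, normDiff p i * iotaU K i x := by
  simp [mu1, normDiff, sum_apply]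

theorem mu1_eq_of_normDiff_eq {p q : HN N} (h : normDiff p = normDiff q) : mu1 K p = mu1 K q := by
  ext x; rw [mu1_apply, mu1_apply, h]

theorem muC_apply (p : HN N) (x : Lie K) :
    muC K p x = ∑ i, iotaU K i x * (-2 * (Real.pi : ℂ) * Complex.I * (p.1 i * p.2 i)) := by
  simp [muC, sum_apply]

theorem muC_act (ζ : Torus N) (p : HN N) : muC K (act ζ p) = muC K p := by
  simp only [muC, act_fst_mul_snd]

theorem contDiff_muC : ContDiff ℝ ∞ (muC K) := by
  refine ContDiff.sum fun i _ => ContDiff.smulRight contDiff_const ?_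
  fun_prop

/-- The projection of `k_ℂ^*` to `k^*` which sends `μ_ℂ` to `∑ Re (z_i w_i) ι^* u_i`. -/
noncomputable def projOne : kDualC K →L[ℝ] kDual K :=
  (-(2 * Real.pi)⁻¹) • ContinuousLinearMap.compL ℝ (Lie K) ℂ ℝ Complex.imCLM

/-- The projection of `k_ℂ^*` to `k^*` which sends `μ_ℂ` to `∑ Im (z_i w_i) ι^* u_i`. -/
noncomputable def projI : kDualC K →L[ℝ] kDual K :=
  (2 * Real.pi)⁻¹ • ContinuousLinearMap.compL ℝ (Lie K) ℂ ℝ Complex.reCLM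

theorem projOne_apply (β : kDualC K) (x : Lie K) :
    projOne K β x = -(2 * Real.pi)⁻¹ * (β x).im := by
  simp [projOne]

theorem projI_apply (β : kDualC K) (x : Lie K) :
    projI K β x = (2 * Real.pi)⁻¹ * (β x).re := by
  simp [projI]

theorem projOne_muC (p : HN N) : projOne K (muC K p) = reMoment (iotaU K) 1 p := by
  ext x
  have hπ := Real.pi_ne_zero
  rw [projOne_apply, muC_apply]
  simp only [reMoment, sum_apply, smul_apply, smul_eq_mul, Complex.im_sum, Finset.mul_sum]
  refine Finset.sum_congr rfl fun i _ => ?_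
  simp [rePart]
  field_simp

theorem projI_muC (p : HN N) : projI K (muC K p) = reMoment (iotaU K) Complex.I p := by
  ext x
  have hπ := Real.pi_ne_zero
  rw [projI_apply, muC_apply]
  simp only [reMoment, sum_apply, smul_apply, smul_eq_mul, Complex.re_sum, Finset.mul_sum]
  refine Finset.sum_congr rfl fun i _ => ?_
  simp [rePart]
  field_simp

theorem eq_of_projOne_eq_of_projI_eq {β γ : kDualC K} (h1 : projOne K β = projOne K γ)
    (h2 : projI K β = projI K γ) : β = γ := by
  ext x
  have hπ := Real.pi_ne_zero
  have h1 := DFunLike.congr_fun h1 x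
  have h2 := DFunLike.congr_fun h2 x
  rw [projOne_apply, projOne_apply] at h1
  rw [projI_apply, projI_apply] at h2
  exact Complex.ext (mul_left_cancel₀ (by positivity) h2)
    (mul_left_cancel₀ (neg_ne_zero.2 (by positivity)) h1)

/-- There is a point with prescribed values of `|z_i|² - |w_i|²` at which all `z_i w_i` vanish. -/
theorem exists_normDiff_eq (a : Fin N → ℝ) :
    ∃ p : HN N, normDiff p = a ∧ (∀ i, p.1 i * p.2 i = 0) ∧
      ∀ i, a i = 0 → p.1 i = 0 ∧ p.2 i = 0 := by
  -- `Real.sqrt` is zero on negative numbers, so at most one of `√a_i` and `√(-a_i)` is nonzero.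
  refine ⟨(fun i => √(a i), fun i => √(-a i)), funext fun i => ?_, fun i => ?_, fun i hi => ?_⟩
  · rcases le_total 0 (a i) with h | h
    · simp [normDiff, Real.sqrt_eq_zero_of_nonpos (neg_nonpos.2 h), h]
    · simp [normDiff, Real.sqrt_eq_zero_of_nonpos h, h]
  · rcases le_total 0 (a i) with h | h
    · simp [Real.sqrt_eq_zero_of_nonpos (neg_nonpos.2 h)]
    · simp [Real.sqrt_eq_zero_of_nonpos h]
  · simp [hi]

theorem hasFDerivAt_mu1_apply_zero {p : HN N} {x : Lie K}
    (h : ∀ i, iotaU K i x = 0 ∨ p.1 i = 0 ∧ p.2 i = 0) :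
    HasFDerivAt (fun q => mu1 K q x) (0 : HN N →L[ℝ] ℝ) p := by
  have hi : ∀ i, HasFDerivAt (fun q : HN N => normDiff q i * iotaU K i x)
      (0 : HN N →L[ℝ] ℝ) p := by
    intro i
    rcases h i with h | ⟨h1, h2⟩
    · simpa [h] using hasFDerivAt_const (0 : ℝ) p
    · let π : (Fin N → ℂ) →L[ℝ] ℂ := ContinuousLinearMap.proj i
      have e1 : HasFDerivAt (fun q : HN N => q.1 i) (π ∘L .fst ℝ _ _) p :=
        (π.hasFDerivAt (x := p.1)).comp p hasFDerivAt_fst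
      have e2 : HasFDerivAt (fun q : HN N => q.2 i) (π ∘L .snd ℝ _ _) p :=
        (π.hasFDerivAt (x := p.2)).comp p hasFDerivAt_snd
      have h := (e1.norm_sq.fun_sub e2.norm_sq).mul_const (iotaU K i x)
      simp only [h1, h2, map_zero, ContinuousLinearMap.zero_comp, smul_zero, sub_zero] at h
      exact h
  simp only [mu1_apply]
  simpa using (HasFDerivAt.fun_sum fun i (_ : i ∈ Finset.univ) => hi i).const_mul Real.pi

/-- If `x ≠ 0` is killed by every `ℓ_i` with `|z_i| ≠ |w_i|`, move `p` to a point `q` of `μ⁻¹(α, 0)`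
with the same `normDiff` and with `z_i = w_i = 0` at the remaining indices. The `x`-component of
`μ₁` is critical at `q`, against regularity. -/
theorem mu1Level_subset_spanningLocus {α : kDual K}
    (hreg : (α, (0 : kDualC K)) ∈ regularValues K) : mu1Level K α ⊆ spanningLocus (iotaU K) := by
  intro p hp x hx
  by_contra hx0
  obtain ⟨q, hq, hmul, hzero⟩ := exists_normDiff_eq (normDiff p)
  have hmu : mu K q = (α, 0) := by
    refine Prod.ext ((mu1_eq_of_normDiff_eq K hq).trans hp) ?_
    simp [mu, muC, hmul]
  obtain ⟨u, hu⟩ := SeparatingDual.exists_eq_one (R := ℝ) hx0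
  obtain ⟨v, hv⟩ := hreg q hmu (u, 0)
  -- `fderiv` is zero where a function is not differentiable, so its being nonzero yields
  -- differentiability.
  have hne : fderiv ℝ (mu K) q ≠ 0 := by
    intro h0
    rw [h0, zero_apply] at hv
    have := congrArg (fun c : kDual K × kDualC K => c.1 x) hv
    simp [hu] at this
  have hd := (not_imp_comm.1 fderiv_zero_of_not_differentiableAt hne).hasFDerivAt
  let ev : kDual K × kDualC K →L[ℝ] ℝ :=
    (ContinuousLinearMap.apply ℝ ℝ x) ∘L (.fst ℝ _ _)
  have h1 : HasFDerivAt (fun q => mu1 K q x) (ev ∘L fderiv ℝ (mu K) q) q :=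
    ev.hasFDerivAt.comp q hd
  have h2 : HasFDerivAt (fun q => mu1 K q x) (0 : HN N →L[ℝ] ℝ) q :=
    hasFDerivAt_mu1_apply_zero K fun i => by
      by_cases hi : normDiff p i = 0
      · exact Or.inr (hzero i hi)
      · exact Or.inl (hx i hi)
  have h3 := DFunLike.congr_fun (h1.unique h2) v
  have h4 : ev (fderiv ℝ (mu K) q v) = 0 := h3
  rw [hv] at h4
  exact one_ne_zero (hu.symm.trans h4)

end Moment

/-! ### Equivariant trivialization of the level set of `μ₁` -/

section Trivialization

variable {N : ℕ} (K : Subgroup (Torus N))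

/-- The retraction onto the zero locus of the complex moment map, paired with that map. -/
noncomputable def trivialize (p : HN N) : HN N × kDualC K :=
  (slide (iotaU K) Complex.I (slide (iotaU K) 1 p 0) 0, muC K p)

/-- The inverse of `trivialize`. -/
noncomputable def untrivialize (x : HN N × kDualC K) : HN N :=
  slide (iotaU K) 1 (slide (iotaU K) Complex.I x.1 (projI K x.2)) (projOne K x.2)

theorem one_mul_conj : (1 : ℂ) * starRingEnd ℂ 1 = 1 := by simp

theorem I_mul_conj : Complex.I * starRingEnd ℂ Complex.I = 1 := by simp

theorem reMoment_one_slide_I (p : HN N) (y : kDual K) :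
    reMoment (iotaU K) 1 (slide (iotaU K) Complex.I p y) = reMoment (iotaU K) 1 p := by
  simp only [reMoment, slide, rePart_one_push_I]

theorem reMoment_I_slide_one (p : HN N) (y : kDual K) :
    reMoment (iotaU K) Complex.I (slide (iotaU K) 1 p y) = reMoment (iotaU K) Complex.I p := by
  simp only [reMoment, slide, rePart_I_push_one]

theorem normDiff_trivialize (p : HN N) : normDiff (trivialize K p).1 = normDiff p := by
  simp only [trivialize, normDiff_slide one_mul_conj, normDiff_slide I_mul_conj]

theorem normDiff_untrivialize (x : HN N × kDualC K) :
    normDiff (untrivialize K x) = normDiff x.1 := by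
  simp only [untrivialize, normDiff_slide one_mul_conj, normDiff_slide I_mul_conj]

theorem trivialize_act (ζ : Torus N) (p : HN N) :
    trivialize K (act ζ p) = (act ζ (trivialize K p).1, (trivialize K p).2) := by
  simp only [trivialize, slide_act, muC_act]

theorem untrivialize_act (ζ : Torus N) (p : HN N) (β : kDualC K) :
    untrivialize K (act ζ p, β) = act ζ (untrivialize K (p, β)) := by
  simp only [untrivialize, slide_act]

variable {K}

theorem muC_trivialize {p : HN N} (hp : p ∈ spanningLocus (iotaU K)) :
    muC K (trivialize K p).1 = 0 := by
  have hp1 := slide_mem_spanningLocus one_mul_conj hp (0 : kDual K)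
  refine eq_of_projOne_eq_of_projI_eq K ?_ ?_
  · rw [projOne_muC, trivialize, reMoment_one_slide_I, reMoment_slide one_mul_conj hp, map_zero]
  · rw [projI_muC, trivialize, reMoment_slide I_mul_conj hp1, map_zero]

theorem muC_untrivialize {x : HN N × kDualC K} (hx : x.1 ∈ spanningLocus (iotaU K)) :
    muC K (untrivialize K x) = x.2 := by
  have hx1 := slide_mem_spanningLocus I_mul_conj hx (projI K x.2)
  refine eq_of_projOne_eq_of_projI_eq K ?_ ?_
  · rw [projOne_muC, untrivialize, reMoment_slide one_mul_conj hx1]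
  · rw [projI_muC, untrivialize, reMoment_I_slide_one, reMoment_slide I_mul_conj hx]

/-- The slides are undone in reverse order. Each one leaves the other component unchanged, so the
recorded `μ_ℂ` supplies the right target for both. -/
theorem untrivialize_trivialize {p : HN N} (hp : p ∈ spanningLocus (iotaU K)) :
    untrivialize K (trivialize K p) = p := by
  have hp1 := slide_mem_spanningLocus one_mul_conj hp (0 : kDual K)
  simp only [untrivialize, trivialize]
  rw [slide_slide_eq_self I_mul_conj hp1 (by rw [reMoment_I_slide_one, projI_muC]),
    slide_slide_eq_self one_mul_conj hp (projOne_muC K p).symm]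

theorem trivialize_untrivialize {x : HN N × kDualC K} (hx : x.1 ∈ spanningLocus (iotaU K))
    (h0 : muC K x.1 = 0) : trivialize K (untrivialize K x) = x := by
  have hx1 := slide_mem_spanningLocus I_mul_conj hx (projI K x.2)
  have h1 : reMoment (iotaU K) 1 x.1 = 0 := by rw [← projOne_muC, h0, map_zero]
  have h2 : reMoment (iotaU K) Complex.I x.1 = 0 := by rw [← projI_muC, h0, map_zero]
  refine Prod.ext ?_ (muC_untrivialize hx)
  simp only [untrivialize, trivialize]
  rw [slide_slide_eq_self one_mul_conj hx1 (by rw [reMoment_one_slide_I, h1]),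
    slide_slide_eq_self I_mul_conj hx h2]

theorem contDiffOn_trivialize :
    ContDiffOn ℝ ∞ (trivialize K) (spanningLocus (iotaU K)) := by
  refine ContDiffOn.prodMk ?_ (contDiff_muC K).contDiffOn
  exact contDiffOn_slide I_mul_conj
    (contDiffOn_slide one_mul_conj contDiffOn_id contDiffOn_const fun _ hp => hp)
    contDiffOn_const fun _ hp => slide_mem_spanningLocus one_mul_conj hp _

theorem contDiffOn_untrivialize :
    ContDiffOn ℝ ∞ (untrivialize K) (spanningLocus (iotaU K) ×ˢ Set.univ) :=
  contDiffOn_slide one_mul_conj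
    (contDiffOn_slide I_mul_conj contDiffOn_fst
      ((projI K).contDiff.comp_contDiffOn contDiffOn_snd) fun _ hx => hx.1)
    ((projOne K).contDiff.comp_contDiffOn contDiffOn_snd)
    fun _ hx => slide_mem_spanningLocus I_mul_conj hx.1 _

variable {α : kDual K}

theorem trivialize_mem_hkLevel (hα : mu1Level K α ⊆ spanningLocus (iotaU K)) {p : HN N}
    (hp : p ∈ mu1Level K α) : (trivialize K p).1 ∈ hkLevel K α 0 :=
  Prod.ext ((mu1_eq_of_normDiff_eq K (normDiff_trivialize K p)).trans hp)
    (muC_trivialize (hα hp))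

theorem hkLevel_subset_mu1Level (α : kDual K) (β : kDualC K) : hkLevel K α β ⊆ mu1Level K α :=
  fun _ h => congrArg Prod.fst h

theorem muC_eq_of_mem_hkLevel {β : kDualC K} {p : HN N} (h : p ∈ hkLevel K α β) :
    muC K p = β :=
  congrArg Prod.snd h

theorem untrivialize_mem_mu1Level {x : HN N × kDualC K} (hx : x.1 ∈ mu1Level K α) :
    untrivialize K x ∈ mu1Level K α :=
  (mu1_eq_of_normDiff_eq K (normDiff_untrivialize K x)).trans hx

/-- The level set of `μ₁` is homeomorphic to the product of the level set of `μ` and `k_ℂ^*`. -/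
noncomputable def mu1LevelHomeomorph (hα : mu1Level K α ⊆ spanningLocus (iotaU K)) :
    mu1Level K α ≃ₜ hkLevel K α 0 × kDualC K where
  toFun p := (⟨(trivialize K p).1, trivialize_mem_hkLevel hα p.2⟩, (trivialize K p).2)
  invFun x := ⟨untrivialize K (x.1, x.2),
    untrivialize_mem_mu1Level (hkLevel_subset_mu1Level α 0 x.1.2)⟩
  left_inv p := Subtype.ext (untrivialize_trivialize (hα p.2))
  right_inv x := by
    have h := trivialize_untrivialize (K := K) (x := (x.1, x.2))
      (hα (hkLevel_subset_mu1Level α 0 x.1.2)) (muC_eq_of_mem_hkLevel x.1.2)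
    exact Prod.ext (Subtype.ext (congrArg (fun y : HN N × kDualC K => y.1) h))
      (congrArg (fun y : HN N × kDualC K => y.2) h)
  continuous_toFun := by
    have h : Continuous fun p : mu1Level K α => trivialize K p :=
      continuousOn_iff_continuous_domRestrict.1 (contDiffOn_trivialize.continuousOn.mono hα)
    exact (h.fst.subtype_mk _).prodMk h.snd
  continuous_invFun :=
    (contDiffOn_untrivialize.continuousOn.comp_continuous
      (continuous_subtype_val.fst'.prodMk continuous_snd)
      fun x => ⟨hα (hkLevel_subset_mu1Level α 0 x.1.2), trivial⟩).subtype_mk _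

/-- The homeomorphism `L(α) ≃ X(α, 0) × k_ℂ^*`. -/
noncomputable def quotientHomeomorph (hα : mu1Level K α ⊆ spanningLocus (iotaU K)) :
    L K α ≃ₜ X K α 0 × kDualC K :=
  quotientHomeomorphProd (orbitSetoid K (mu1Level K α)) (orbitSetoid K (hkLevel K α 0))
    (mu1LevelHomeomorph hα) fun p q => by
      constructor
      · rintro ⟨ζ, hζ, h⟩
        have h' := trivialize_act K ζ p
        rw [h] at h'
        exact ⟨⟨ζ, hζ, (congrArg Prod.fst h').symm⟩, (congrArg Prod.snd h').symm⟩
      · rintro ⟨⟨ζ, hζ, h⟩, h'⟩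
        refine ⟨ζ, hζ, ?_⟩
        have h1 : act ζ (trivialize K p).1 = (trivialize K q).1 := h
        have h2 : (trivialize K p).2 = (trivialize K q).2 := h'
        -- Equivariance of the inverse carries the element `ζ` relating the images back to the
        -- original points.
        rw [← untrivialize_trivialize (hα q.2), ← Prod.mk.eta (p := trivialize K q), ← h1, ← h2,
          untrivialize_act, Prod.mk.eta, untrivialize_trivialize (hα p.2)]

end Trivialization

end ToricHK

theorem mainTheorem7 {N : ℕ} (K : Subgroup (ToricHK.Torus N))
    (hKclosed : IsClosed (K : Set (ToricHK.Torus N)))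
    (hKconn : IsConnected (K : Set (ToricHK.Torus N)))
    (α : ToricHK.kDual K)
    (hreg : (α, (0 : ToricHK.kDualC K)) ∈ ToricHK.regularValues K) :
    ToricHK.OrbifoldDiffeomorphic (ToricHK.projL K α) (ToricHK.projXV K α 0) ∧
      Nonempty (ContinuousMap.HomotopyEquiv (ToricHK.X K α 0) (ToricHK.L K α)) := by
  have hα := ToricHK.mu1Level_subset_spanningLocus K hreg
  let Φ := ToricHK.quotientHomeomorph hα
  have hopen := ToricHK.isOpen_spanningLocus (ToricHK.iotaU K)
  -- A single lift serves near every point in each direction: `trivialize` and `untrivialize` are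
  -- smooth on open sets containing the level sets.
  refine ⟨⟨Φ, fun p => ⟨_, hopen, hα p.2, ToricHK.trivialize K, ToricHK.contDiffOn_trivialize,
      fun x _ => ⟨⟨ToricHK.trivialize_mem_hkLevel hα x.2, trivial⟩, rfl⟩⟩,
    fun p => ⟨_, hopen.prod isOpen_univ,
      ⟨hα (ToricHK.hkLevel_subset_mu1Level α 0 p.2.1), trivial⟩, ToricHK.untrivialize K,
      ToricHK.contDiffOn_untrivialize, fun x _ =>
        ⟨ToricHK.untrivialize_mem_mu1Level (ToricHK.hkLevel_subset_mu1Level α 0 x.2.1), rfl⟩⟩⟩, ?_⟩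
  obtain ⟨e⟩ := ToricHK.nonempty_homotopyEquiv_prod_of_contractible
    (ToricHK.X K α 0) (ToricHK.kDualC K)
  exact ⟨e.trans Φ.symm.toHomotopyEquiv⟩
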